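/- Let $G=(V,E)$ be a finite multigraph (loops and parallel edges allowed) that is $(2,0)$-tight, i.e. $|E|=2|V|$ and every $X\subseteq V$ induces at most $2|X|$ edges, and suppose that no two distinct vertices of $G$ are joined by four (or more) parallel edges. Let $\Gamma\le O(2)$ be a group of order $4$ with $k(\Gamma)=0$. Here $k(\Gamma)$ is the dimension of the group $\operatorname{Isom}(\Gamma)$ of all isometries $g$ of $\mathbb{R}^2$ that preserve $\Gamma$-symmetry: whenever $\mathbf p: W\times\Gamma\to\mathbb{R}^2$ satisfies $\mathbf p(w,\gamma)=\gamma\,\mathbf p(w,1)$ for all $w,\gamma$, so does $g\circ\mathbf p$. Then there is a gain map $\phi$ of $G$ with values in $\Gamma$ such that $(G,\phi)$ is $\Gamma$-symmetrically rigid in $\mathbb{R}^2$. The notions used are the following. Let $\vec E$ be the set of triples $(e,v,w)$ where $e\in E$ has ends $v$ and $w$. A gain map is a map $\phi:\vec E\to\Gamma$ such that $\phi(e,v,w)=\phi(e,w,v)^{-1}$ whenever $v\ne w$; $\phi(e,v,w)\ne\phi(e',v,w)$ for every two distinct edges $e,e'$ with ends $v,w$ (including two loops at $v=w$); and $\phi(e,v,v)\neq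 1$ for every loop $e$ at $v$. For $p:V\to\mathbb{R}^2$, the orbit rigidity matrix $R(G,\phi,p)$ is the real matrix with rows indexed by $E$ and columns by $V\times\{1,2\}$ whose entry at $(e,(v,j))$ is $[p(v)-\phi(e,v,w)p(w)]_j$ if $e$ has ends $v$ and $w\neq v$, $[2p(v)-\gamma p(v)-\gamma^{-1}p(v)]_j$ with $\gamma=\phi(e,v,v)$ if $e$ is a loop at $v$, and $0$ otherwise. A flex of $(G,\phi,p)$ is a map $u:V\to\mathbb{R}^2$ in the kernel of $R(G,\phi,p)$; it is trivial if there are a skew-symmetric matrix $T$ and a vector $x$ with $\gamma u(v)=T\gamma p(v)+x$ for all $v\in V$ and $\gamma\in\Gamma$. The pair $(G,\phi)$ is $\Gamma$-symmetrically rigid in $\mathbb{R}^2$ if there is a $p:V\to\mathbb{R}^2$ such that every flex of $(G,\phi,p)$ is trivial. -/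

import Mathlib

open scoped Graph InnerProductSpace

namespace SymRigid

/-- `d`-dimensional Euclidean space. -/
abbrev Euc (d : ℕ) : Type := EuclideanSpace ℝ (Fin d)

/-- The group of isometries of `d`-dimensional Euclidean space. -/
abbrev Isom (d : ℕ) : Type := Euc d ≃ᵃⁱ[ℝ] Euc d

/-- `O(d)`, as the subgroup of the isometries that fix the origin. -/
def orthogonal (d : ℕ) : Subgroup (Isom d) where
  carrier := {g | g 0 = 0}
  one_mem' := by simp
  mul_mem' := by
    intro a b ha hb
    simp only [Set.mem_ofPred_eq] at ha hb ⊢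
    simp [ha, hb]
  inv_mem' := by
    intro a ha
    simp only [Set.mem_ofPred_eq] at ha ⊢
    calc a⁻¹ 0 = a⁻¹ (a 0) := by rw [ha]
      _ = 0 := by simp

section Groups

variable {d : ℕ}

/-- `P : W × Γ → ℝ^d` is a `Γ`-symmetric placement of the vertices `W × Γ` of a covering graph:
`P (w, γ) = γ (P (w, 1))`. -/
def IsSymmetricPlacement (Γ : Subgroup (Isom d)) {W : Type*} (P : W × Γ → Euc d) : Prop :=
  ∀ (w : W) (γ : Γ), P (w, γ) = (γ : Isom d) (P (w, 1))

/-- `g` preserves `Γ`-symmetry: `g ∘ P` is a `Γ`-symmetric placement whenever `P` is one. -/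
def PreservesSymmetry (Γ : Subgroup (Isom d)) (g : Isom d) : Prop :=
  ∀ (W : Type) [Finite W] (P : W × Γ → Euc d),
    IsSymmetricPlacement Γ P → IsSymmetricPlacement Γ (fun x => g (P x))

/-- The isometries that preserve `Γ`-symmetry are those that commute with `Γ`. -/
theorem preservesSymmetry_iff (Γ : Subgroup (Isom d)) (g : Isom d) :
    PreservesSymmetry Γ g ↔ ∀ γ ∈ Γ, ∀ q : Euc d, g (γ q) = γ (g q) := by
  constructor
  · intro h γ hγ q
    have := h Unit (fun x => (x.2 : Isom d) q) (fun w γ => by simp) () ⟨γ, hγ⟩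
    simpa using this
  · intro h W _ P hP w γ
    show g (P (w, γ)) = (γ : Isom d) (g (P (w, 1)))
    rw [hP w γ, h _ γ.2]

/-- The group `Isom(Γ)` of the isometries that preserve `Γ`-symmetry. -/
def isomGroup (Γ : Subgroup (Isom d)) : Subgroup (Isom d) where
  carrier := {g | PreservesSymmetry Γ g}
  one_mem' := by simp [preservesSymmetry_iff]
  mul_mem' := by
    intro a b ha hb
    simp only [Set.mem_ofPred_eq, preservesSymmetry_iff] at ha hb ⊢
    intro γ hγ q
    simp [hb γ hγ, ha γ hγ]
  inv_mem' := by
    intro a ha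
    simp only [Set.mem_ofPred_eq, preservesSymmetry_iff] at ha ⊢
    intro γ hγ q
    apply a.injective
    rw [ha γ hγ]
    simp

/-- The Lie algebra of a closed subgroup `H` of the isometry group, realised by the affine vector
fields `x ↦ T x + b` (encoded as the pair `(T, b)`) that are the initial velocities of the
one-parameter subgroups of `H`. For closed `H` these velocities form a subspace already; taking the
span makes this a submodule by construction. -/
def lieAlgebra (H : Subgroup (Isom d)) : Submodule ℝ ((Euc d →ₗ[ℝ] Euc d) × Euc d) :=
  Submodule.span ℝ {ξ | ∃ c : Multiplicative ℝ →* Isom d,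
    (∀ t : ℝ, c (Multiplicative.ofAdd t) ∈ H) ∧
    ∀ x : Euc d, HasDerivAt (fun t : ℝ => c (Multiplicative.ofAdd t) x) (ξ.1 x + ξ.2) 0}

/-- `k(Γ) = dim Isom(Γ)`, the dimension as a Lie group of the (closed) group `Isom(Γ)`. -/
noncomputable def k (Γ : Subgroup (Isom d)) : ℕ := Module.finrank ℝ (lieAlgebra (isomGroup Γ))

end Groups

section Graphs

variable {α β : Type*}

/-- The number `i_G(X)` of edges of the subgraph of `G` induced by `X`. -/
noncomputable def inducedEdgeCount (G : Graph α β) (X : Set α) : ℕ := (E(G.induce X)).ncard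

/-- `G` is `(k, l)`-sparse: every set `X` of vertices that induces an edge induces at most
`k |X| - l` edges. -/
def IsSparse (G : Graph α β) (k l : ℕ) : Prop :=
  ∀ X ⊆ V(G), 0 < inducedEdgeCount G X → inducedEdgeCount G X + l ≤ k * X.ncard

/-- `G` is `(k, l)`-tight: it is `(k, l)`-sparse and `|E| = k |V| - l`. -/
def IsTight (G : Graph α β) (k l : ℕ) : Prop :=
  IsSparse G k l ∧ (E(G)).ncard + l = k * (V(G)).ncard

/-- `G` has no four distinct edges with the same two distinct ends. -/
def NoQuadrupleParallel (G : Graph α β) : Prop :=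
  ∀ v w : α, v ≠ w → ¬ ∃ F : Finset β, F.card = 4 ∧ ∀ e ∈ F, G.IsLink e v w

/-- `φ` is a gain map of `G` with values in `Γ`. Only its values at the triples `(e, v, w)` in which
`e` is an edge of `G` with ends `v` and `w` are relevant. -/
structure IsGainMap {Γ : Type*} [Group Γ] (G : Graph α β) (φ : β → α → α → Γ) : Prop where
  inv : ∀ e v w, G.IsLink e v w → v ≠ w → φ e v w = (φ e w v)⁻¹
  parallel : ∀ e e' v w, e ≠ e' → G.IsLink e v w → G.IsLink e' v w → φ e v w ≠ φ e' v w
  loop : ∀ e v, G.IsLoopAt e v → φ e v v ≠ 1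

variable {d : ℕ} {Γ : Subgroup (Isom d)}

open Classical in
/-- The orbit rigidity matrix `R(G, φ, p)`, with rows indexed by the edges and columns indexed by
the pairs of a vertex and a coordinate. -/
noncomputable def orbitMatrix (G : Graph α β) (φ : β → α → α → Γ) (p : V(G) → Euc d) :
    Matrix E(G) (V(G) × Fin d) ℝ :=
  Matrix.of fun e x =>
    if h : G.Inc e x.1 then
      let w : V(G) := ⟨h.other, h.isLink_other.right_mem⟩
      let γ : Isom d := φ e x.1 w
      if x.1 = w then ((2 : ℝ) • p x.1 - γ (p x.1) - γ⁻¹ (p x.1)) x.2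
      else (p x.1 - γ (p w)) x.2
    else 0

/-- `u` is a flex of the orbit framework `(G, φ, p)`: it is in the kernel of the orbit rigidity
matrix. -/
def IsFlex (G : Graph α β) [Fintype V(G)] (φ : β → α → α → Γ) (p u : V(G) → Euc d) : Prop :=
  (orbitMatrix G φ p).mulVec (fun x => u x.1 x.2) = 0

/-- The flex `u` of an orbit framework with orbit placement `p` is trivial: the corresponding flex
`(v, γ) ↦ γ_ℓ (u v)` of the framework on the covering graph with placement `(v, γ) ↦ γ (p v)`,
where `γ_ℓ` is the linear part of `γ`, is of the form `T · + x` with `T` skew-symmetric. -/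
def IsTrivialFlex (G : Graph α β) (Γ : Subgroup (Isom d)) (p u : V(G) → Euc d) : Prop :=
  ∃ (T : Euc d →ₗ[ℝ] Euc d) (x : Euc d), (∀ a b, ⟪T a, b⟫_ℝ = -⟪a, T b⟫_ℝ) ∧
    ∀ (v : V(G)) (γ : Γ),
      (γ : Isom d).linearIsometryEquiv (u v) = T ((γ : Isom d) (p v)) + x

/-- The gain graph `(G, φ)` is `Γ`-symmetrically rigid in `ℝ^d`: for some orbit placement, every
flex of the orbit framework is trivial. -/
def IsSymmetricallyRigid (G : Graph α β) [Fintype V(G)] (φ : β → α → α → Γ) : Prop :=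
  ∃ p : V(G) → Euc d, ∀ u : V(G) → Euc d, IsFlex G φ p u → IsTrivialFlex G Γ p u

end Graphs

end SymRigid

/-! In suitable orthonormal coordinates `Γ` consists of all four matrices diag(±1, ±1): k = 0 forces
a reflection, since rotations about the origin commute with a group of rotations, and a group of
order four is abelian (`exists_diagonal_coordinates`).

It then suffices to find signs and a placement making the 2|V| rows independent. The only flex is
then 0, and the gain map conditions come for free: parallel edges with equal gains have equal rows,
and a loop with gain 1 has a zero row.

A row is affine in the diagonal entries of its gain, so by multilinearity of the determinant the
signs may be relaxed to real parameters (`exists_signs_det_ne_zero`). By Hall's theorem the edges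
can be oriented so that two enter each vertex. The real parameters are chosen so that, after
rescaling columns, an edge vw with chosen point q has as blocks the chords from q to v and from q to
w of a parabola. With q at the tail w, only the block at the head v survives. Two nonparallel chords
then kill a kernel vector at v; if both edges entering v share a tail, a point used at that tail
supplies the second chord (`exists_det_ne_zero`). -/

namespace SymRigid

/-! ### Independent rows for diagonal gains -/

section OrbitRows

variable {V : Type*} [DecidableEq V]

/-- The row of the orbit matrix of an edge with ends `v` and `w` whose gain is the diagonal matrix
with entries `σ`. -/
def edgeRow (p : V × Fin 2 → ℝ) (v w : V) (σ : Fin 2 → ℝ) : V × Fin 2 → ℝ := fun x =>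
  (if x.1 = v then p (v, x.2) - σ x.2 * p (w, x.2) else 0) +
    (if x.1 = w then p (w, x.2) - σ x.2 * p (v, x.2) else 0)

theorem edgeRow_comm (p : V × Fin 2 → ℝ) (v w : V) (σ : Fin 2 → ℝ) :
    edgeRow p v w σ = edgeRow p w v σ := by
  funext x
  exact add_comm _ _

theorem edgeRow_self_one (p : V × Fin 2 → ℝ) (v : V) : edgeRow p v v 1 = 0 := by
  funext x
  simp [edgeRow]

theorem edgeRow_dotProduct [Fintype V] (p u : V × Fin 2 → ℝ) (v w : V) (σ : Fin 2 → ℝ) :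
    edgeRow p v w σ ⬝ᵥ u = ∑ j, ((p (v, j) - σ j * p (w, j)) * u (v, j) +
      (p (w, j) - σ j * p (v, j)) * u (w, j)) := by
  simp only [dotProduct, edgeRow, add_mul, ite_mul, zero_mul, Finset.sum_add_distrib,
    Fintype.sum_prod_type]
  congr 1
  · rw [Finset.sum_eq_single v] <;> simp +contextual
  · rw [Finset.sum_eq_single w] <;> simp +contextual

/-- The real numbers `±1` as a function of a pair of signs. -/
def signs (s : ℤˣ × ℤˣ) : Fin 2 → ℝ := ![((s.1 : ℤ) : ℝ), ((s.2 : ℤ) : ℝ)]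

/-- A row with arbitrary real parameters is an affine combination of the rows with parameters
`±1`. -/
theorem edgeRow_eq_sum_signs (p : V × Fin 2 → ℝ) (v w : V) (σ : Fin 2 → ℝ) :
    edgeRow p v w σ = ∑ s : ℤˣ × ℤˣ,
      ((1 + signs s 0 * σ 0) * (1 + signs s 1 * σ 1) / 4) • edgeRow p v w (signs s) := by
  -- The entry at coordinate j is affine in `σ j` alone, and the weights are products of the
  -- interpolation weights (1 ± `σ j`)/2 at the nodes ±1.
  funext ⟨x, j⟩
  rw [Fintype.sum_prod_type, UnitsInt.univ]
  fin_cases j <;> simp [edgeRow, signs] <;> split_ifs <;> ring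

/-- Real parameters making the rows independent can be replaced by signs. -/
theorem exists_signs_det_ne_zero [Fintype V] (p : V × Fin 2 → ℝ) (τ : V × Fin 2 → V)
    (σ : V × Fin 2 → Fin 2 → ℝ)
    (h : (Matrix.of fun i : V × Fin 2 => edgeRow p i.1 (τ i) (σ i)).det ≠ 0) :
    ∃ s : V × Fin 2 → ℤˣ × ℤˣ,
      (Matrix.of fun i : V × Fin 2 => edgeRow p i.1 (τ i) (signs (s i))).det ≠ 0 := by
  by_contra! h0
  apply h
  have key := (Matrix.detRowAlternating (n := V × Fin 2) (R := ℝ)).toMultilinearMap.map_sum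
    (fun i (s : ℤˣ × ℤˣ) => ((1 + signs s 0 * σ i 0) * (1 + signs s 1 * σ i 1) / 4) •
      edgeRow p i.1 (τ i) (signs s))
  simp only [← edgeRow_eq_sum_signs, MultilinearMap.map_smul_univ] at key
  refine key.trans (Finset.sum_eq_zero fun s _ => ?_)
  rw [smul_eq_zero]
  exact Or.inr (h0 s)

/-- Coordinates on which orthogonality to two chords of a parabola forces a vector to vanish. -/
theorem eq_zero_of_chords {a b c s t : ℝ} (hb : a ≠ b) (hc : a ≠ c) (hbc : b ≠ c)
    (h1 : (a - b) * s + (a ^ 2 - b ^ 2) * t = 0) (h2 : (a - c) * s + (a ^ 2 - c ^ 2) * t = 0) :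
    s = 0 ∧ t = 0 := by
  have e1 : s + (a + b) * t = 0 :=
    (mul_eq_zero.1 (by linear_combination h1 : (a - b) * (s + (a + b) * t) = 0)).resolve_left
      (sub_ne_zero.2 hb)
  have e2 : s + (a + c) * t = 0 :=
    (mul_eq_zero.1 (by linear_combination h2 : (a - c) * (s + (a + c) * t) = 0)).resolve_left
      (sub_ne_zero.2 hc)
  have ht : t = 0 := (mul_eq_zero.1 (by linear_combination e1 - e2 : (b - c) * t = 0)).resolve_left
    (sub_ne_zero.2 hbc)
  subst ht
  exact ⟨by linear_combination e1, rfl⟩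

/-- An orientation in which every vertex `v` has exactly two entering edges `(v, 0)`, `(v, 1)`, with
tails given by `τ`, and in which no two vertices are joined by four edges, has independent rows for
some placement and some real parameters. -/
theorem exists_det_ne_zero [Fintype V] (τ : V × Fin 2 → V)
    (hτ : ∀ v w, v ≠ w → ¬ ((∀ k, τ (v, k) = w) ∧ ∀ k, τ (w, k) = v)) :
    ∃ (p : V × Fin 2 → ℝ) (σ : V × Fin 2 → Fin 2 → ℝ),
      (Matrix.of fun i : V × Fin 2 => edgeRow p i.1 (τ i) (σ i)).det ≠ 0 := by
  classical
  -- Vertices are the left summands; the right summands are spare points, one per edge slot, used by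
  -- loops.
  obtain ⟨κ, hκ0, hκ⟩ : ∃ κ : V ⊕ (V × Fin 2) → ℝ, (∀ q, κ q ≠ 0) ∧
      ∀ q r, q ≠ r → κ q ^ 2 ≠ κ r ^ 2 := by
    refine ⟨fun q => ((Fintype.equivFin _ q : ℕ) : ℝ) + 1, fun q => by positivity, ?_⟩
    intro q r hqr h
    rw [sq_eq_sq₀ (by positivity) (by positivity)] at h
    exact hqr ((Fintype.equivFin _).injective (Fin.ext (by exact_mod_cast add_right_cancel h)))
  -- the points chosen for the edges: the tail, or a fresh point for a loop
  let tp : V × Fin 2 → V ⊕ (V × Fin 2) := fun i => if τ i = i.1 then .inr i else .inl (τ i)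
  have tp_ne : ∀ i, tp i ≠ .inl i.1 := by
    intro i
    by_cases h : τ i = i.1 <;> simp [tp, h]
  have tp_eq : ∀ v, tp (v, 0) = tp (v, 1) → (∀ k, τ (v, k) = τ (v, 1)) ∧ τ (v, 1) ≠ v := by
    intro v h
    by_cases h0 : τ (v, 0) = v <;> by_cases h1 : τ (v, 1) = v <;> simp [tp, h0, h1] at h
    refine ⟨fun k => ?_, h1⟩
    fin_cases k
    · exact h
    · rfl
  -- If both edges entering v come from w, some edge entering w does not come from v, as otherwise
  -- four parallel edges would join v and w.
  have alt : ∀ v, tp (v, 0) = tp (v, 1) → ∃ k, tp (τ (v, 1), k) ≠ .inl v := by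
    intro v h
    obtain ⟨h1, h2⟩ := tp_eq v h
    by_contra! hk
    refine hτ v _ h2.symm ⟨h1, fun k => ?_⟩
    have := hk k
    by_cases h0 : τ (τ (v, 1), k) = τ (v, 1) <;> simp [tp, h0] at this
    exact this
  choose! f hf using alt
  let Q : V × Fin 2 → V ⊕ (V × Fin 2) := fun i =>
    if i.2 = 1 ∧ tp (i.1, 0) = tp (i.1, 1) then tp (τ (i.1, 1), f i.1) else tp i
  let p : V × Fin 2 → ℝ := fun x => κ (.inl x.1) ^ (x.2.val + 1)
  -- With K = κ², this parameter turns p(v, j) - σ p(w, j) into (K_v^(j+1) - K_Q^(j+1)) / p(v, j), a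
  -- chord of the parabola (K, K²) up to column scaling, and likewise at w.
  refine ⟨p, fun i j => (κ (Q i) ^ 2) ^ (j.val + 1) / (p (i.1, j) * p (τ i, j)), fun hdet => ?_⟩
  obtain ⟨u, hu0, hu⟩ := Matrix.exists_mulVec_eq_zero_iff.2 hdet
  apply hu0
  have p0 : ∀ x, p x ≠ 0 := fun x => pow_ne_zero _ (hκ0 _)
  let K : V ⊕ (V × Fin 2) → ℝ := fun q => κ q ^ 2
  let z : V × Fin 2 → ℝ := fun x => u x / p x
  have hrow : ∀ i, ((K (.inl i.1) - K (Q i)) * z (i.1, 0) +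
      (K (.inl i.1) ^ 2 - K (Q i) ^ 2) * z (i.1, 1)) +
      ((K (.inl (τ i)) - K (Q i)) * z (τ i, 0) +
      (K (.inl (τ i)) ^ 2 - K (Q i) ^ 2) * z (τ i, 1)) = 0 := by
    intro i
    have := congrFun hu i
    simp only [Matrix.mulVec, Matrix.of_apply, Pi.zero_apply] at this
    change edgeRow _ _ _ _ ⬝ᵥ u = 0 at this
    have h00 := hκ0 (.inl i.1)
    have h01 := hκ0 (.inl (τ i))
    rw [edgeRow_dotProduct, Fin.sum_univ_two] at this
    rw [← this]
    simp only [z, K, p]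
    simp
    field_simp
    ring
  let ℓ : V → V ⊕ (V × Fin 2) → ℝ := fun v q =>
    (K (.inl v) - K q) * z (v, 0) + (K (.inl v) ^ 2 - K q ^ 2) * z (v, 1)
  have ℓ_self : ∀ v, ℓ v (.inl v) = 0 := fun v => by simp [ℓ]
  have hrow' : ∀ i, ℓ i.1 (Q i) + ℓ (τ i) (Q i) = 0 := hrow
  -- At the tail's own point the tail term vanishes; for a loop the two terms coincide.
  have hprim : ∀ i, Q i = tp i → ℓ i.1 (tp i) = 0 := by
    intro i hi
    have h := hrow' i
    rw [hi] at h
    by_cases hl : τ i = i.1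
    · rw [hl] at h
      linarith
    · have ht : tp i = .inl (τ i) := by simp [tp, hl]
      rw [ht, ℓ_self, add_zero] at h
      rwa [ht]
  have hQ0 : ∀ v, Q (v, 0) = tp (v, 0) := fun v => by simp [Q]
  -- This holds at every vertex, also those with a repeated tail, and so can be used at the tail in
  -- `hz`.
  have htp : ∀ v k, ℓ v (tp (v, k)) = 0 := by
    intro v k
    fin_cases k
    · exact hprim (v, 0) (hQ0 v)
    · by_cases h : tp (v, 0) = tp (v, 1)
      · have := hprim (v, 0) (hQ0 v)
        rwa [h] at this
      · exact hprim (v, 1) (by simp [Q, h])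
  have hz : ∀ v, z (v, 0) = 0 ∧ z (v, 1) = 0 := by
    intro v
    by_cases h : tp (v, 0) = tp (v, 1)
    · have hQ : Q (v, 1) = tp (τ (v, 1), f v) := by simp [Q, h]
      have h1 := hrow' (v, 1)
      rw [hQ, htp, add_zero] at h1
      have ht : tp (v, 1) = .inl (τ (v, 1)) := by simp [tp, (tp_eq v h).2]
      have h0 := htp v 1
      rw [ht] at h0
      refine eq_zero_of_chords (hκ _ _ ?_) (hκ _ _ (hf v h).symm) (hκ _ _ ?_) h0 h1
      · simpa using (tp_eq v h).2.symm
      · exact (tp_ne (τ (v, 1), f v)).symm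
    · exact eq_zero_of_chords (hκ _ _ (tp_ne (v, 0)).symm) (hκ _ _ (tp_ne (v, 1)).symm)
        (hκ _ _ h) (htp v 0) (htp v 1)
  funext ⟨v, j⟩
  have : z (v, j) = 0 := by
    fin_cases j
    · exact (hz v).1
    · exact (hz v).2
  exact (div_eq_zero_iff.1 this).resolve_right (p0 _)

/-- A multigraph with vertex set `V` and edges `e` with ends `a e`, `b e`, that is `(2, 0)`-tight and
has no four parallel edges, has signs and a placement for which the rows of its edges are
independent. -/
theorem exists_signs_of_tight {E : Type*} [Fintype V] [Fintype E] [DecidableEq E] (a b : E → V)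
    (hcard : Fintype.card E = 2 * Fintype.card V)
    (hsparse : ∀ F : Finset E, F.card ≤ 2 * (F.biUnion fun e => {a e, b e}).card)
    (hquad : ∀ v w, v ≠ w → ¬ ∃ F : Finset E, F.card = 4 ∧
      ∀ e ∈ F, (a e = v ∧ b e = w) ∨ (a e = w ∧ b e = v)) :
    ∃ (p : V × Fin 2 → ℝ) (s : E → ℤˣ × ℤˣ),
      (∀ u, (∀ e, edgeRow p (a e) (b e) (signs (s e)) ⬝ᵥ u = 0) → u = 0) ∧
      Function.Injective (fun e => edgeRow p (a e) (b e) (signs (s e))) ∧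
      ∀ e, edgeRow p (a e) (b e) (signs (s e)) ≠ 0 := by
  classical
  -- Hall's theorem, with two slots per vertex: sparsity is the Hall condition, and the edge count
  -- makes the matching bijective.
  obtain ⟨h, hinj, hmem⟩ := (Finset.all_card_le_biUnion_card_iff_exists_injective
    fun e => ({a e, b e} : Finset V) ×ˢ (Finset.univ : Finset (Fin 2))).1 (by
      intro F
      have : (F.biUnion fun e => ({a e, b e} : Finset V) ×ˢ (Finset.univ : Finset (Fin 2))) =
          (F.biUnion fun e => {a e, b e}) ×ˢ Finset.univ := by
        ext ⟨v, k⟩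
        simp
      rw [this, Finset.card_product, Finset.card_univ, Fintype.card_fin, mul_comm]
      exact hsparse F)
  have hbij : Function.Bijective h :=
    (Fintype.bijective_iff_injective_and_card h).2 ⟨hinj, by simp [hcard, mul_comm]⟩
  let H : E ≃ V × Fin 2 := Equiv.ofBijective h hbij
  have hend : ∀ e, (H e).1 = a e ∨ (H e).1 = b e := fun e => by simpa [H] using hmem e
  let τ : V × Fin 2 → V := fun i => if i.1 = a (H.symm i) then b (H.symm i) else a (H.symm i)
  have hτ : ∀ i, (a (H.symm i) = i.1 ∧ b (H.symm i) = τ i) ∨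
      (a (H.symm i) = τ i ∧ b (H.symm i) = i.1) := by
    intro i
    have := hend (H.symm i)
    rw [H.apply_symm_apply] at this
    by_cases h1 : i.1 = a (H.symm i)
    · simp [τ, ← h1]
    · simp [τ, h1, (this.resolve_left h1).symm]
  obtain ⟨p, σ, hdet⟩ := exists_det_ne_zero τ (by
    rintro v w hvw ⟨h1, h2⟩
    refine hquad v w hvw ⟨(({v, w} : Finset V) ×ˢ Finset.univ).map H.symm.toEmbedding, ?_, ?_⟩
    · rw [Finset.card_map, Finset.card_product, Finset.card_pair hvw]
      rfl
    · intro e he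
      obtain ⟨⟨x, k⟩, hx, rfl⟩ := Finset.mem_map.1 he
      have hx' : x = v ∨ x = w := by simpa using hx
      have := hτ (x, k)
      rcases hx' with rfl | rfl
      · rw [h1 k] at this
        exact this
      · rw [h2 k] at this
        exact this.symm)
  obtain ⟨s, hdet⟩ := exists_signs_det_ne_zero p τ σ hdet
  have hrow : ∀ e, edgeRow p (a e) (b e) (signs (s (H e))) =
      edgeRow p (H e).1 (τ (H e)) (signs (s (H e))) := by
    intro e
    have := hτ (H e)
    rw [H.symm_apply_apply] at this
    rcases this with ⟨h1, h2⟩ | ⟨h1, h2⟩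
    · rw [h1, h2]
    · rw [h1, h2, edgeRow_comm]
  refine ⟨p, fun e => s (H e), ?_, ?_, ?_⟩
  · intro u hu
    by_contra h0
    refine hdet (Matrix.exists_mulVec_eq_zero_iff.1 ⟨u, h0, funext fun i => ?_⟩)
    have := hu (H.symm i)
    rw [hrow, H.apply_symm_apply] at this
    exact this
  · intro e e' hee
    by_contra hne
    simp only [hrow] at hee
    exact hdet (Matrix.det_zero_of_row_eq (fun h => hne (H.injective h)) hee)
  · intro e h0
    rw [hrow] at h0
    exact hdet (Matrix.det_eq_zero_of_row_eq_zero (H e) fun j => congrFun h0 j)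

end OrbitRows

/-! ### Subgroups of order four in O(2) -/

section OrderFour

theorem apply_eq_linearIsometryEquiv {d : ℕ} {g : Isom d} (hg : g ∈ orthogonal d) (x : Euc d) :
    g x = g.linearIsometryEquiv x := by
  have h := g.map_vadd 0 x
  have h0 : g 0 = 0 := hg
  simpa [h0] using h

/-- The identification of the complex numbers with the Euclidean plane. -/
noncomputable def planeEquiv : ℂ ≃ₗᵢ[ℝ] Euc 2 := Complex.orthonormalBasisOneI.repr

/-- An element of `O(2)` is a rotation or a reflection. -/
theorem exists_circle_of_mem_orthogonal {g : Isom 2} (hg : g ∈ orthogonal 2) :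
    ∃ a : Circle, (∀ z, g (planeEquiv z) = planeEquiv (a * z)) ∨
      ∀ z, g (planeEquiv z) = planeEquiv (a * (starRingEnd ℂ) z) := by
  obtain ⟨a, ha⟩ := linear_isometry_complex
    ((planeEquiv.trans g.linearIsometryEquiv).trans planeEquiv.symm)
  refine ⟨a, ha.imp (fun h z => ?_) fun h z => ?_⟩ <;>
  · have := congrArg planeEquiv (DFunLike.congr_fun h z)
    simpa [apply_eq_linearIsometryEquiv hg] using this

/-- The one-parameter group of the rotations about the origin. -/
noncomputable def rotationHom : Multiplicative ℝ →* Isom 2 :=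
  MonoidHom.mk' (fun t => ((planeEquiv.symm.trans (rotation (Circle.exp t.toAdd))).trans
    planeEquiv).toAffineIsometryEquiv) (by
      intro s t
      ext1 x
      simp)

theorem rotationHom_apply (t : ℝ) (z : ℂ) :
    rotationHom (Multiplicative.ofAdd t) (planeEquiv z) = planeEquiv (Circle.exp t * z) := by
  simp [rotationHom]

/-- A subgroup of `O(2)` with `k = 0` contains a reflection. -/
theorem exists_reflection {Γ : Subgroup (Isom 2)} (hΓ : Γ ≤ orthogonal 2) (hk : k Γ = 0) :
    ∃ g ∈ Γ, ∃ a : Circle, ∀ z, g (planeEquiv z) = planeEquiv (a * (starRingEnd ℂ) z) := by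
  by_contra! h0
  have hrot : ∀ g ∈ Γ, ∃ a : Circle, ∀ z, g (planeEquiv z) = planeEquiv (a * z) := by
    intro g hg
    obtain ⟨a, h | h⟩ := exists_circle_of_mem_orthogonal (hΓ hg)
    · exact ⟨a, h⟩
    · obtain ⟨z, hz⟩ := h0 g hg a
      exact absurd (h z) hz
  -- The velocity of the rotation group at time 0, a nonzero element of the Lie algebra.
  let T : Euc 2 →ₗ[ℝ] Euc 2 := planeEquiv.toLinearEquiv.toLinearMap ∘ₗ
    LinearMap.mulLeft ℝ Complex.I ∘ₗ planeEquiv.symm.toLinearEquiv.toLinearMap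
  have hT : ∀ z, T (planeEquiv z) = planeEquiv (Complex.I * z) := fun z => by simp [T]
  have hmem : (T, (0 : Euc 2)) ∈ lieAlgebra (isomGroup Γ) := by
    refine Submodule.subset_span ⟨rotationHom, fun t => ?_, fun x => ?_⟩
    · refine (preservesSymmetry_iff Γ _).2 fun g hg q => ?_
      obtain ⟨a, ha⟩ := hrot g hg
      obtain ⟨z, rfl⟩ := planeEquiv.surjective q
      rw [ha, rotationHom_apply, rotationHom_apply, ha, mul_left_comm]
    · obtain ⟨z, rfl⟩ := planeEquiv.surjective x
      have hd : HasDerivAt (fun t : ℝ => (Circle.exp t : ℂ) * z) (Complex.I * z) 0 := by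
        have h1 : HasDerivAt (fun t : ℝ => Complex.exp (t * Complex.I)) Complex.I 0 := by
          have h2 : HasDerivAt (fun t : ℝ => (t : ℂ) * Complex.I) (1 * Complex.I) 0 :=
            (Complex.ofRealCLM.hasDerivAt (x := 0)).mul_const _
          simpa using h2.cexp
        simpa [Circle.coe_exp] using h1.mul_const z
      have := (planeEquiv.toContinuousLinearEquiv.toContinuousLinearMap.hasFDerivAt
        (x := (Circle.exp 0 : ℂ) * z)).comp_hasDerivAt (0 : ℝ) hd
      simp only [rotationHom_apply, hT, add_zero]
      exact this
  rw [Submodule.finrank_eq_zero.1 hk, Submodule.mem_bot, Prod.mk_eq_zero] at hmem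
  have := hT 1
  rw [hmem.1] at this
  have h1 := planeEquiv.injective ((map_zero planeEquiv).trans this)
  rw [mul_one] at h1
  exact Complex.I_ne_zero h1.symm

/-- A subgroup of order four of `O(2)` with `k = 0` consists of the diagonal matrices with
entries `±1` in suitable orthonormal coordinates. -/
theorem exists_diagonal_coordinates {Γ : Subgroup (Isom 2)} (hΓ : Γ ≤ orthogonal 2) (hk : k Γ = 0)
    (hcard : Nat.card Γ = 4) :
    ∃ Φ : ℂ ≃ₗᵢ[ℝ] Euc 2, ∀ s : ℤˣ × ℤˣ, ∃ γ : Γ, ∀ z : ℂ,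
      (γ : Isom 2) (Φ z) = Φ ⟨signs s 0 * z.re, signs s 1 * z.im⟩ := by
  obtain ⟨g, hg, a, ha⟩ := exists_reflection hΓ hk
  -- Rotating by a square root of `a` moves the mirror of `g` to the real axis, so that `g` becomes
  -- complex conjugation.
  obtain ⟨w, hw⟩ : ∃ w : Circle, w * w = a := by
    refine ⟨Circle.exp (Complex.arg a / 2), ?_⟩
    rw [← Circle.exp_add, add_halves, Circle.exp_arg]
  have hwc : (w : ℂ) * (starRingEnd ℂ) w = 1 := by
    rw [Complex.mul_conj, Circle.normSq_coe, Complex.ofReal_one]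
  let Φ : ℂ ≃ₗᵢ[ℝ] Euc 2 := (rotation w).trans planeEquiv
  have hΦ : ∀ z, Φ z = planeEquiv (w * z) := fun z => by simp [Φ]
  have hgΦ : ∀ z, g (Φ z) = Φ ((starRingEnd ℂ) z) := by
    intro z
    rw [hΦ, hΦ, ha, ← hw, map_mul (starRingEnd ℂ), Circle.coe_mul]
    congr 1
    linear_combination ((w : ℂ) * (starRingEnd ℂ) z) * hwc
  have : Finite Γ := Nat.finite_of_card_ne_zero (by omega)
  obtain ⟨t, ht1, htg⟩ : ∃ t : Γ, t ≠ 1 ∧ t ≠ ⟨g, hg⟩ := by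
    classical
    have := Fintype.ofFinite Γ
    have hlt : ({1, ⟨g, hg⟩} : Finset Γ).card < (Finset.univ : Finset Γ).card := by
      rw [Finset.card_univ, ← Nat.card_eq_fintype_card, hcard]
      exact lt_of_le_of_lt Finset.card_le_two (by norm_num)
    obtain ⟨t, -, ht⟩ := Finset.exists_mem_notMem_of_card_lt_card hlt
    rw [Finset.mem_insert, Finset.mem_singleton, not_or] at ht
    exact ⟨t, ht⟩
  have hcomm : (t : Isom 2) * g = g * t := by
    have : Fact (Nat.Prime 2) := ⟨Nat.prime_two⟩
    have hc := (IsPGroup.isMulCommutative_of_card_eq_prime_sq (p := 2) (G := Γ)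
      (by simpa using hcard)).is_comm.comm t ⟨g, hg⟩
    exact congrArg Subtype.val hc
  have ext_Φ : ∀ h h' : Isom 2, (∀ z, h (Φ z) = h' (Φ z)) → h = h' := by
    intro h h' hh
    ext1 x
    obtain ⟨z, rfl⟩ := Φ.surjective x
    exact hh z
  have hneg : (∀ z, (t : Isom 2) (Φ z) = Φ (-z)) ∨
      ∀ z, (t : Isom 2) (Φ z) = Φ (-(starRingEnd ℂ) z) := by
    have hcΦ : ∀ z, (t : Isom 2) (Φ ((starRingEnd ℂ) z)) = g ((t : Isom 2) (Φ z)) := by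
      intro z
      rw [← hgΦ]
      exact congrArg (fun h : Isom 2 => h (Φ z)) hcomm
    have hreal : ∀ c : ℂ, ‖c‖ = 1 → (starRingEnd ℂ) c = c → c = 1 ∨ c = -1 := by
      intro c hn hc
      obtain ⟨r, rfl⟩ := Complex.conj_eq_iff_real.1 hc
      rw [Complex.norm_real, Real.norm_eq_abs] at hn
      rcases eq_or_eq_neg_of_abs_eq hn with rfl | rfl <;> simp
    obtain ⟨b, hb | hb⟩ := exists_circle_of_mem_orthogonal (hΓ t.2)
    · have hbΦ : ∀ z, (t : Isom 2) (Φ z) = Φ (b * z) := by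
        intro z
        rw [hΦ, hΦ, hb, mul_left_comm]
      -- Commuting with conjugation makes the unit multiplier real, hence ±1; the value 1 is
      -- excluded by the choice of `t`.
      have h1 := hcΦ 1
      rw [hbΦ, hbΦ, hgΦ] at h1
      have h2 := Φ.injective h1
      rw [map_one, mul_one] at h2
      rcases hreal b b.norm_coe h2.symm with h | h
      · refine absurd (Subtype.ext (ext_Φ _ _ fun z => ?_)) ht1
        simp [hbΦ, h]
      · exact Or.inl fun z => by simp [hbΦ, h]
    · let c : ℂ := b * (starRingEnd ℂ) w * (starRingEnd ℂ) w
      have hbΦ : ∀ z, (t : Isom 2) (Φ z) = Φ (c * (starRingEnd ℂ) z) := by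
        intro z
        rw [hΦ, hΦ, hb, map_mul (starRingEnd ℂ)]
        congr 1
        simp only [c]
        linear_combination (-(b : ℂ) * (starRingEnd ℂ) w * (starRingEnd ℂ) z) * hwc
      have h1 := hcΦ 1
      rw [hbΦ, hbΦ, hgΦ] at h1
      have h2 := Φ.injective h1
      simp only [map_one, mul_one] at h2
      rcases hreal c (by simp [c, Circle.norm_coe]) h2.symm with h | h
      · refine absurd (Subtype.ext (ext_Φ _ _ fun z => ?_)) htg
        simp [hbΦ, h, hgΦ]
      · exact Or.inr fun z => by simp [hbΦ, h]
  refine ⟨Φ, ?_⟩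
  have hsigns : ∀ e d : ℤˣ, signs (e, d) 0 = ((e : ℤ) : ℝ) ∧ signs (e, d) 1 = ((d : ℤ) : ℝ) :=
    fun e d => ⟨rfl, rfl⟩
  rintro ⟨e, d⟩
  rw [(hsigns e d).1, (hsigns e d).2]
  have hconj : ∀ z : ℂ, (starRingEnd ℂ) z = ⟨z.re, -z.im⟩ := fun z => rfl
  have hn : ∀ z : ℂ, -z = ⟨-z.re, -z.im⟩ := fun z => rfl
  have hnc : ∀ z : ℂ, -(starRingEnd ℂ) z = ⟨-z.re, z.im⟩ := fun z => by
    apply Complex.ext <;> simp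
  rcases Int.units_eq_one_or e with rfl | rfl <;> rcases Int.units_eq_one_or d with rfl | rfl
  · exact ⟨1, fun z => by simp⟩
  · exact ⟨⟨g, hg⟩, fun z => by simp [hgΦ, hconj]⟩
  · rcases hneg with h | h
    · exact ⟨t * ⟨g, hg⟩, fun z => by simp [hgΦ, h, ← hnc]⟩
    · exact ⟨t, fun z => by simp [h, ← hnc]⟩
  · rcases hneg with h | h
    · exact ⟨t, fun z => by simp [h, ← hn]⟩
    · exact ⟨t * ⟨g, hg⟩, fun z => by simp [hgΦ, h, ← hn]⟩

end OrderFour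

/-! ### The orbit matrix and edge counts of the graph -/

section OrbitMatrix

variable {α β : Type*} {d : ℕ} {Γ : Subgroup (Isom d)} {G : Graph α β}

open Classical in
/-- The entries of the orbit matrix in the row of an edge whose gain is an involution. -/
theorem orbitMatrix_apply_of_isLink (γ : β → Γ) (hγ : ∀ e, γ e * γ e = 1) (p : V(G) → Euc d)
    (e : E(G)) {v w : V(G)} (h : G.IsLink e v w) (y : V(G)) (j : Fin d) :
    orbitMatrix G (fun e _ _ => γ e) p e (y, j) =
      (if y = v then (p v - (γ e : Isom d) (p w)) j else 0) +
        (if y = w then (p w - (γ e : Isom d) (p v)) j else 0) := by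
  have hinv : ((γ e : Isom d))⁻¹ = γ e := by
    rw [← Subgroup.coe_inv, inv_eq_of_mul_eq_one_left (hγ e)]
  by_cases hy : G.Inc e y
  · have hoth := hy.isLink_other
    rcases h.eq_and_eq_or_eq_and_eq hoth with ⟨h1, h2⟩ | ⟨h1, h2⟩
    · obtain rfl : v = y := Subtype.ext h1
      have hw : (⟨hy.other, hoth.right_mem⟩ : V(G)) = w := Subtype.ext h2.symm
      simp only [orbitMatrix, Matrix.of_apply, dif_pos hy, hw, hinv]
      -- For a loop the involution gives 2p - γp - γ⁻¹p = 2(p - γp), the sum of the two end terms.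
      by_cases hvw : v = w
      · subst hvw
        simp
        ring
      · simp [hvw]
    · obtain rfl : w = y := Subtype.ext h2
      have hw : (⟨hy.other, hoth.right_mem⟩ : V(G)) = v := Subtype.ext h1.symm
      simp only [orbitMatrix, Matrix.of_apply, dif_pos hy, hw, hinv]
      by_cases hvw : w = v
      · subst hvw
        simp
        ring
      · simp [hvw]
  · have hv : y ≠ v := fun h' => hy (h' ▸ h.inc_left)
    have hw : y ≠ w := fun h' => hy (h' ▸ h.inc_right)
    simp [orbitMatrix, hy, hv, hw]

theorem orbitMatrix_mulVec_of_isLink [Fintype V(G)] (γ : β → Γ) (hγ : ∀ e, γ e * γ e = 1)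
    (p u : V(G) → Euc d) (e : E(G)) {v w : V(G)} (h : G.IsLink e v w) :
    (orbitMatrix G (fun e _ _ => γ e) p).mulVec (fun x => u x.1 x.2) e =
      ⟪p v - (γ e : Isom d) (p w), u v⟫_ℝ + ⟪p w - (γ e : Isom d) (p v), u w⟫_ℝ := by
  classical
  simp only [Matrix.mulVec, dotProduct, Fintype.sum_prod_type,
    orbitMatrix_apply_of_isLink γ hγ p e h, add_mul, ite_mul, zero_mul, Finset.sum_add_distrib]
  congr 1
  · rw [Finset.sum_eq_single v] <;> simp +contextual [PiLp.inner_apply, mul_comm]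
  · rw [Finset.sum_eq_single w] <;> simp +contextual [PiLp.inner_apply, mul_comm]

/-- The edge counts of a `(2, 0)`-sparse graph, for finite sets of edges. -/
theorem card_le_of_isSparse [DecidableEq V(G)] (hE : E(G).Finite) (hG : IsSparse G 2 0)
    (a b : E(G) → V(G)) (hab : ∀ e : E(G), G.IsLink e (a e) (b e)) (F : Finset E(G)) :
    F.card ≤ 2 * (F.biUnion fun e => {a e, b e}).card := by
  set X := F.biUnion fun e : E(G) => ({a e, b e} : Finset V(G)) with hX
  rcases F.eq_empty_or_nonempty with rfl | hF
  · simp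
  -- Needed because `ncard` of an infinite set is 0.
  have hfin : (E(G.induce (Subtype.val '' (X : Set V(G))))).Finite :=
    hE.subset fun e he => by
      obtain ⟨x, y, h, -⟩ := he
      exact h.edge_mem
  have hsub : Subtype.val '' (F : Set E(G)) ⊆ E(G.induce (Subtype.val '' (X : Set V(G)))) := by
    rintro _ ⟨e, he, rfl⟩
    have hmem : ∀ x, x = a e ∨ x = b e → x ∈ X := fun x hx => by
      rw [hX, Finset.mem_biUnion]
      exact ⟨e, he, by simpa using hx⟩
    exact ⟨a e, b e, hab e, ⟨_, hmem _ (Or.inl rfl), rfl⟩, ⟨_, hmem _ (Or.inr rfl), rfl⟩⟩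
  have hle : F.card ≤ inducedEdgeCount G (Subtype.val '' (X : Set V(G))) := by
    have := Set.ncard_le_ncard hsub hfin
    rwa [Set.ncard_image_of_injective _ Subtype.val_injective, Set.ncard_coe_finset] at this
  have := hG (Subtype.val '' (X : Set V(G))) (by rintro _ ⟨x, -, rfl⟩; exact x.2)
    (lt_of_lt_of_le hF.card_pos hle)
  rw [Set.ncard_image_of_injective _ Subtype.val_injective, Set.ncard_coe_finset] at this
  omega

end OrbitMatrix

end SymRigid

/-! ### Assembling the gain map and the placement -/

open SymRigid in
theorem mainTheorem4 {α β : Type*} (Γ : Subgroup (SymRigid.Isom 2))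
    (hΓ : Γ ≤ SymRigid.orthogonal 2) (hk : SymRigid.k Γ = 0) (hcard : Nat.card Γ = 4)
    (G : Graph α β) [Fintype V(G)] (hE : E(G).Finite)
    (htight : SymRigid.IsTight G 2 0) (hquad : SymRigid.NoQuadrupleParallel G) :
    ∃ φ : β → α → α → Γ,
      SymRigid.IsGainMap G φ ∧ SymRigid.IsSymmetricallyRigid G φ := by
  classical
  obtain ⟨Φ, hΦ⟩ := exists_diagonal_coordinates hΓ hk hcard
  choose g hg using hΦ
  have ext_Φ : ∀ h h' : Γ, (∀ z, (h : Isom 2) (Φ z) = (h' : Isom 2) (Φ z)) → h = h' := by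
    intro h h' hh
    apply Subtype.ext
    ext1 x
    obtain ⟨z, rfl⟩ := Φ.surjective x
    exact hh z
  have hsq : ∀ s j, signs s j * signs s j = 1 := by
    intro s j
    rcases Int.units_eq_one_or s.1 with h1 | h1 <;> rcases Int.units_eq_one_or s.2 with h2 | h2 <;>
      fin_cases j <;> simp [signs, h1, h2]
  have hgg : ∀ s, g s * g s = 1 := fun s => ext_Φ _ _ fun z => by
    simp [hg, ← mul_assoc, hsq]
  have hsigns : ∀ s s', g s = g s' → signs s = signs s' := by
    intro s s' h
    have h1 := hg s ⟨1, 1⟩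
    rw [h, hg] at h1
    have h2 := Complex.ext_iff.1 (Φ.injective h1)
    funext j
    fin_cases j
    · simpa using h2.1.symm
    · simpa using h2.2.symm
  have : Fintype E(G) := hE.fintype
  have hends : ∀ e : E(G), ∃ v w : V(G), G.IsLink e v w := by
    intro e
    obtain ⟨x, y, h⟩ := G.exists_isLink_of_mem_edgeSet e.2
    exact ⟨⟨x, h.left_mem⟩, ⟨y, h.right_mem⟩, h⟩
  choose a b hab using hends
  obtain ⟨P, s, hker, hinj, hne⟩ := exists_signs_of_tight a b
    (by
      have := htight.2
      rwa [add_zero, ← Nat.card_coe_set_eq, ← Nat.card_coe_set_eq, Nat.card_eq_fintype_card,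
        Nat.card_eq_fintype_card] at this)
    (card_le_of_isSparse hE htight.1 a b hab) (by
      rintro v w hvw ⟨F, hF, hlink⟩
      refine hquad v w (fun h => hvw (Subtype.ext h))
        ⟨F.map (Function.Embedding.subtype _), by rw [Finset.card_map, hF], fun e he => ?_⟩
      obtain ⟨e, heF, rfl⟩ := Finset.mem_map.1 he
      rcases hlink e heF with ⟨h1, h2⟩ | ⟨h1, h2⟩
      · exact h1 ▸ h2 ▸ hab e
      · exact (h1 ▸ h2 ▸ hab e : G.IsLink e w v).symm)
  have hrow : ∀ e v w, (hl : G.IsLink (e : E(G)) v w) → edgeRow P (a e) (b e) (signs (s e)) =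
      edgeRow P ⟨v, hl.left_mem⟩ ⟨w, hl.right_mem⟩ (signs (s e)) := by
    intro e v w hl
    rcases (hab e).eq_and_eq_or_eq_and_eq hl with ⟨h1, h2⟩ | ⟨h1, h2⟩
    · congr 1
      · exact Subtype.ext h1
      · exact Subtype.ext h2
    · rw [edgeRow_comm]
      congr 1
      · exact Subtype.ext h2
      · exact Subtype.ext h1
  let γ : β → Γ := fun e => if he : e ∈ E(G) then g (s ⟨e, he⟩) else 1
  have hγ : ∀ e : E(G), γ e = g (s e) := fun e => dif_pos e.2
  have hγγ : ∀ e, γ e * γ e = 1 := by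
    intro e
    by_cases he : e ∈ E(G)
    · simp only [γ, dif_pos he, hgg]
    · simp [γ, he]
  refine ⟨fun e _ _ => γ e, ⟨fun e v w _ _ => ?_, fun e e' v w hee h h' heq => ?_,
    fun e v h heq => ?_⟩, fun v => Φ ⟨P (v, 0), P (v, 1)⟩, fun u hu => ?_⟩
  · exact (inv_eq_of_mul_eq_one_left (hγγ e)).symm
  · lift e to E(G) using h.edge_mem
    lift e' to E(G) using h'.edge_mem
    rw [hγ, hγ] at heq
    -- Equal gains on parallel edges would give equal rows.
    refine hee (congrArg Subtype.val (hinj ?_))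
    beta_reduce
    rw [hrow e v w h, hrow e' v w h', hsigns _ _ heq]
  · have hl : G.IsLink e v v := h
    lift e to E(G) using hl.edge_mem
    rw [hγ] at heq
    -- A loop with trivial gain would give a zero row.
    apply hne e
    have h1 : g 1 = 1 := ext_Φ _ _ fun z => by simp [hg, signs]
    rw [hrow e v v hl, hsigns _ 1 (heq.trans h1.symm)]
    have : signs 1 = 1 := by
      funext j
      fin_cases j <;> simp [signs]
    rw [this, edgeRow_self_one]
  · let z : V(G) → ℂ := fun v => Φ.symm (u v)
    have hz : ∀ v, u v = Φ (z v) := fun v => (Φ.apply_symm_apply _).symm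
    -- In the coordinates `Φ` a flex lies in the kernel of the independent rows, so it vanishes.
    have hz0 : (fun x : V(G) × Fin 2 => ![(z x.1).re, (z x.1).im] x.2) = 0 := by
      refine hker _ fun e => ?_
      have h1 := congrFun hu e
      rw [orbitMatrix_mulVec_of_isLink γ hγγ _ _ e (hab e), hγ, hg, hg, hz, hz, ← map_sub,
        ← map_sub, Φ.inner_map_map, Φ.inner_map_map, Pi.zero_apply] at h1
      rw [edgeRow_dotProduct, ← h1]
      simp [Fin.sum_univ_two, Complex.inner]
      ring
    have hu0 : ∀ v, u v = 0 := by
      intro v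
      have : z v = 0 := Complex.ext (congrFun hz0 (v, 0)) (congrFun hz0 (v, 1))
      rw [hz, this, map_zero]
    exact ⟨0, 0, by simp, fun v γ => by simp [hu0]⟩
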